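/- Let $0\le l\le n$ be integers and let $S_n$ act on $(\mathbb C^2)^{\otimes n}$ by permuting the tensor factors. Let $H_l^{(n)}\subseteq(\mathbb C^2)^{\otimes n}$ be the $S_n$-invariant subspace spanned by the computational basis vectors $|x\rangle$ with $x\in\{0,1\}^n$ of Hamming weight $l$. For an integer $k\ge 0$ let $$A_k^{(l)}=\sum_{x,y:\ d(x,y)=2k}|x\rangle\langle y|$$ be the operator on $H_l^{(n)}$, where $x,y$ range over the bit strings of length $n$ and weight $l$, and $d$ is the Hamming distance. For a partition $\lambda$ of $n$, the irreducible representation of $S_n$ labeled by $\lambda$ is the left ideal of $\mathbb C[S_n]$ generated by the Young symmetrizer (the product of the column antisymmetrizers times the product of the row symmetrizers) of a tableau of shape $\lambda$; up to isomorphism it does not depend on the tableau. Then there are $S_n$-invariant, pairwise orthogonal subspaces $B_j\subseteq H_l^{(n)}$, $0\le j\le\min\{l,n-l\}$, such that $$H_l^{(n)}=\bigoplus_{j=0}^{\min\{l,n-l\}}B_j ,$$ where each $B_j$ is irreducible and isomorphic to the irreducible representation labeled by $(n-j,j)$ (for every tableau of that shape), and the $B_j$ are pairwise non-isomorphic, so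 that the decomposition is multiplicity-free. Moreover, there are real numbers $\alpha_k(j)$ such that for every $k\ge 0$ $$A_k^{(l)}=\sum_{j=0}^{\min\{l,n-l\}}\alpha_k(j)\,P_j ,$$ where $P_j$ is the orthogonal projection of $H_l^{(n)}$ onto $B_j$, and each $\alpha_k(j)$ is an eigenvalue of $A_k^{(l)}$. -/

import Mathlib

/-! ### The irreducible representations of the symmetric group, via Young symmetrizers -/

/-- A Young tableau of shape `μ`: a filling of the cells of `μ` by the elements of `Fin n`, each
used exactly once, given by the map sending an entry to its cell `(row, column)`. -/
abbrev YoungTableau (n : ℕ) (μ : YoungDiagram) : Type := Fin n ≃ μ.cells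

namespace YoungTableau

variable {n : ℕ} {μ : YoungDiagram}

/-- The row containing the entry `i`. -/
def row (T : YoungTableau n μ) (i : Fin n) : ℕ := (T i).1.1

/-- The column containing the entry `i`. -/
def col (T : YoungTableau n μ) (i : Fin n) : ℕ := (T i).1.2

/-- The permutations that preserve every row of `T`. -/
def rowStabilizer (T : YoungTableau n μ) : Finset (Equiv.Perm (Fin n)) :=
  Finset.univ.filter fun σ => ∀ i, T.row (σ i) = T.row i

/-- The permutations that preserve every column of `T`. -/
def colStabilizer (T : YoungTableau n μ) : Finset (Equiv.Perm (Fin n)) :=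
  Finset.univ.filter fun σ => ∀ i, T.col (σ i) = T.col i

/-- The product over all rows of `T` of the symmetrizers of the rows. -/
noncomputable def rowSymmetrizer (T : YoungTableau n μ) :
    MonoidAlgebra ℂ (Equiv.Perm (Fin n)) :=
  ∑ σ ∈ T.rowStabilizer, MonoidAlgebra.of ℂ _ σ

/-- The product over all columns of `T` of the antisymmetrizers of the columns. -/
noncomputable def colAntisymmetrizer (T : YoungTableau n μ) :
    MonoidAlgebra ℂ (Equiv.Perm (Fin n)) :=
  ∑ σ ∈ T.colStabilizer, ((Equiv.Perm.sign σ : ℤ) : ℂ) • MonoidAlgebra.of ℂ _ σ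

/-- The (unnormalized) Young symmetrizer of `T`. -/
noncomputable def youngSymmetrizer (T : YoungTableau n μ) :
    MonoidAlgebra ℂ (Equiv.Perm (Fin n)) :=
  T.colAntisymmetrizer * T.rowSymmetrizer

/-- The left ideal of the group algebra `ℂ[Sₙ]` generated by the Young symmetrizer of `T`. -/
noncomputable def youngIdeal (T : YoungTableau n μ) :
    Submodule (MonoidAlgebra ℂ (Equiv.Perm (Fin n))) (MonoidAlgebra ℂ (Equiv.Perm (Fin n))) :=
  Submodule.span _ {T.youngSymmetrizer}

/-- The representation of `Sₙ` labelled by the partition `μ` of `n` (in the form attached to the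
tableau `T` of shape `μ`): `Sₙ` acts by left multiplication on the left ideal of `ℂ[Sₙ]` generated
by the Young symmetrizer of `T`. -/
noncomputable def youngRep (T : YoungTableau n μ) :
    Representation ℂ (Equiv.Perm (Fin n)) T.youngIdeal :=
  Representation.ofModule' T.youngIdeal

end YoungTableau

/-- The Young diagram of the partition `(n - j, j)` of `n`, for `j ≤ n / 2`. -/
def twoRowDiagram (n j : ℕ) (h : 2 * j ≤ n) : YoungDiagram :=
  YoungDiagram.ofRowLens [n - j, j] (by
    rw [List.sortedGE_iff_pairwise]
    simp
    omega)

/-- The diagram of `(n - j, j)` has `n` cells. -/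
theorem twoRowDiagram_card (n j : ℕ) (h : 2 * j ≤ n) : (twoRowDiagram n j h).card = n := by
  have : (twoRowDiagram n j h).cells =
      ({0} : Finset ℕ) ×ˢ Finset.range (n - j) ∪ ({1} : Finset ℕ) ×ˢ Finset.range j := by
    ext ⟨a, b⟩
    rw [YoungDiagram.mem_cells, twoRowDiagram, YoungDiagram.mem_ofRowLens]
    rcases a with _ | _ | a <;> simp
  rw [YoungDiagram.card, this, Finset.card_union_of_disjoint]
  · simp; omega
  · rw [Finset.disjoint_left]
    rintro ⟨a, b⟩ h1 h2
    simp at h1 h2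
    omega

/-- There are tableaux of shape `(n - j, j)`. -/
theorem youngTableau_twoRow_nonempty (n j : ℕ) (h : 2 * j ≤ n) :
    Nonempty (YoungTableau n (twoRowDiagram n j h)) :=
  ⟨Fintype.equivOfCardEq (by
    have := twoRowDiagram_card n j h
    rw [YoungDiagram.card] at this
    simp [this])⟩

/-! ### Qubits, bit strings of fixed weight, and the distance operators -/

/-- The Hilbert space `(ℂ²)^{⊗ n}` of `n` qubits, in its orthonormal computational basis, which is
indexed by the bit strings of length `n`. -/
abbrev QubitSpace (n : ℕ) : Type := EuclideanSpace ℂ (Fin n → Fin 2)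

/-- The computational basis vector `|x⟩`. -/
noncomputable def ket {n : ℕ} (x : Fin n → Fin 2) : QubitSpace n := EuclideanSpace.single x 1

/-- The representation `π ↦ V_π` of `Sₙ` on `n` qubits by permutation of the tensor factors. -/
noncomputable def permRep (n : ℕ) : Representation ℂ (Equiv.Perm (Fin n)) (QubitSpace n) where
  toFun π :=
    { toFun := fun ψ => WithLp.toLp 2 fun x => ψ (x ∘ π)
      map_add' := fun _ _ => rfl
      map_smul' := fun _ _ => rfl }
  map_one' := rfl
  map_mul' _ _ := rfl

/-- `V_π |x₁ … xₙ⟩ = |y₁ … yₙ⟩` with `y_i = x_{π⁻¹(i)}`. -/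
theorem permRep_ket {n : ℕ} (π : Equiv.Perm (Fin n)) (x : Fin n → Fin 2) :
    permRep n π (ket x) = ket (x ∘ π.symm) := by
  have key (y : Fin n → Fin 2) : y ∘ π = x ↔ y = x ∘ π.symm :=
    ⟨fun h => by rw [← h]; ext i; simp, fun h => by rw [h]; ext i; simp⟩
  ext y
  change (EuclideanSpace.single x (1 : ℂ) : QubitSpace n) (y ∘ π) =
    (EuclideanSpace.single (x ∘ π.symm) (1 : ℂ) : QubitSpace n) y
  simp [key]

/-- The Hamming weight of a bit string is invariant under permutation of the positions. -/
theorem hammingNorm_comp_perm {n : ℕ} (x : Fin n → Fin 2) (π : Equiv.Perm (Fin n)) :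
    hammingNorm (x ∘ π) = hammingNorm x := by
  unfold hammingNorm
  refine Finset.card_bij (fun i _ => π i) ?_ ?_ ?_
  · intro i hi
    simpa using hi
  · intro i _ j _ hij
    exact π.injective hij
  · intro i hi
    exact ⟨π.symm i, by simpa using hi, by simp⟩

/-- The space `H_l^{(n)}`: the span of the basis vectors `|x⟩` over the bit strings `x` of length
`n` with exactly `l` ones. -/
noncomputable def weightSpace (n l : ℕ) : Submodule ℂ (QubitSpace n) :=
  Submodule.span ℂ (ket '' {x | hammingNorm x = l})

/-- `H_l^{(n)}` as a subrepresentation of the representation of `Sₙ` on `n` qubits. -/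
noncomputable def weightSubrep (n l : ℕ) : Subrepresentation (permRep n) where
  toSubmodule := weightSpace n l
  apply_mem_toSubmodule π v hv := by
    refine (Submodule.span_le.2 ?_ :
      weightSpace n l ≤ (weightSpace n l).comap (permRep n π)) hv
    rintro _ ⟨x, hx, rfl⟩
    refine Submodule.subset_span ⟨x ∘ π.symm, ?_, (permRep_ket π x).symm⟩
    exact (hammingNorm_comp_perm x π.symm).trans hx

/-- The representation of `Sₙ` on `H_l^{(n)}`. -/
noncomputable def weightRep (n l : ℕ) :
    Representation ℂ (Equiv.Perm (Fin n)) (weightSpace n l) :=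
  (weightSubrep n l).toRepresentation

/-- The basis vector `|x⟩` of `H_l^{(n)}`, for a bit string `x` with exactly `l` ones. -/
noncomputable def weightKet {n l : ℕ} (x : {x : Fin n → Fin 2 // hammingNorm x = l}) :
    weightSpace n l :=
  ⟨ket x.1, Submodule.subset_span ⟨x.1, x.2, rfl⟩⟩

/-- The operator `A_k^{(l)} = ∑_{x, y : d(x, y) = 2k} |x⟩⟨y|` on `H_l^{(n)}`, where `x` and `y` run
over the bit strings with exactly `l` ones and `d` is the Hamming distance. -/
noncomputable def distanceOperator (n l k : ℕ) : weightSpace n l →L[ℂ] weightSpace n l :=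
  ∑ x : {x : Fin n → Fin 2 // hammingNorm x = l}, ∑ y : {x : Fin n → Fin 2 // hammingNorm x = l},
    if hammingDist x.1 y.1 = 2 * k then
      InnerProductSpace.rankOne ℂ (weightKet x) (weightKet y)
    else 0

/-- The orthogonal projection of `H_l^{(n)}` onto a subspace `W` of it, as an operator on
`H_l^{(n)}`. -/
noncomputable def weightProj {n l : ℕ} (W : Submodule ℂ (weightSpace n l)) :
    weightSpace n l →L[ℂ] weightSpace n l :=
  Submodule.starProjection (𝕜 := ℂ) (E := weightSpace n l) W

/-! The proof counts dimensions in the commutant and never computes the dimension of an irreducible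
representation.

Upper bound: an intertwining map of `H_l` has matrix entries that are constant on the `S_n`-orbits
of pairs of weight-`l` strings. Such an orbit is determined by the Hamming distance, which takes
only values `2k` with `0 ≤ k ≤ min l (n - l)`; so the commutant has dimension at most `min l (n - l)
+ 1` (`finrank_intertwiningMap_weightRep_le`).

Lower bound: for each `j ≤ min l (n - l)` the polytabloids of shape `(n - j, j)` span a nonzero
invariant subspace of `H_l`, and different `j` give orthogonal subspaces (`polytabloid_ne_zero`,
`isOrtho_spechtSubrep_of_lt`).

The projections onto these blocks are linearly independent elements of the commutant, so they span
it (`exists_eq_sum_projIntertwining`). Writing a suitable intertwiner as a combination of them gives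
each claim: the identity for completeness, the projection onto a smaller invariant subspace for
irreducibility, an isomorphism of blocks extended by zero for multiplicity-freeness, and `A_k` for
the spectral formula.

The label of a block comes from letting the left ideal of the Young symmetrizer act on `rowVector l
T`. This maps onto the block for every `l` and is injective for `l = j`; irreducibility carries
injectivity over to the other weights (`nonempty_equiv_youngRep`). -/

/-! ### Orthogonal invariant subspaces filling a small commutant. -/

section OrthogonalDecomposition

open Representation

variable {G E : Type*} [Group G] [NormedAddCommGroup E] [InnerProductSpace ℂ E]
  [FiniteDimensional ℂ E] {ρ : Representation ℂ G E}

/-- The orthogonal projection onto an invariant subspace commutes with a unitary action. -/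
theorem starProjection_comm_of_unitary (hρ : ∀ g u v, inner ℂ (ρ g u) (ρ g v) = inner ℂ u v)
    (W : Subrepresentation ρ) (g : G) (v : E) :
    W.toSubmodule.starProjection (ρ g v) = ρ g (W.toSubmodule.starProjection v) := by
  refine Submodule.eq_starProjection_of_mem_of_inner_eq_zero
    (W.apply_mem_toSubmodule g (Submodule.starProjection_apply_mem _ v)) fun w hw => ?_
  have h := Submodule.starProjection_inner_eq_zero (K := W.toSubmodule) v (ρ g⁻¹ w)
    (W.apply_mem_toSubmodule _ hw)
  rw [← hρ g, ← Module.End.mul_apply, ← map_mul] at h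
  simpa [inner_sub_left] using h

/-- The orthogonal projection onto a subrepresentation of a unitary representation, as an
intertwining map. -/
noncomputable def projIntertwining (hρ : ∀ g u v, inner ℂ (ρ g u) (ρ g v) = inner ℂ u v)
    (W : Subrepresentation ρ) : IntertwiningMap ρ ρ where
  toLinearMap := W.toSubmodule.starProjection.toLinearMap
  isIntertwining' g := LinearMap.ext fun v => starProjection_comm_of_unitary hρ W g v

theorem projIntertwining_apply (hρ : ∀ g u v, inner ℂ (ρ g u) (ρ g v) = inner ℂ u v)
    (W : Subrepresentation ρ) (v : E) :
    projIntertwining hρ W v = W.toSubmodule.starProjection v := rfl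

variable {ι : Type*} [Fintype ι] {B : ι → Subrepresentation ρ}

theorem sum_projIntertwining_apply_of_mem
    (hρ : ∀ g u v, inner ℂ (ρ g u) (ρ g v) = inner ℂ u v)
    (horth : ∀ i j, i ≠ j → (B i).toSubmodule ⟂ (B j).toSubmodule) (c : ι → ℂ) {j : ι} {v : E}
    (hv : v ∈ (B j).toSubmodule) :
    (∑ i, c i • projIntertwining hρ (B i)) v = c j • v := by
  rw [IntertwiningMap.sum_apply, Finset.sum_eq_single j]
  · rw [IntertwiningMap.smul_apply, projIntertwining_apply,
      Submodule.starProjection_eq_self_iff.2 hv]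
  · intro i _ hij
    rw [IntertwiningMap.smul_apply, projIntertwining_apply,
      Submodule.starProjection_apply_eq_zero_iff _ |>.2 ?_, smul_zero]
    exact (horth j i hij.symm) hv
  · simp

/-- If there are as many nonzero orthogonal invariant subspaces as the dimension of the commutant,
then the projections onto them span the commutant. -/
theorem exists_eq_sum_projIntertwining
    (hρ : ∀ g u v, inner ℂ (ρ g u) (ρ g v) = inner ℂ u v)
    (horth : ∀ i j, i ≠ j → (B i).toSubmodule ⟂ (B j).toSubmodule)
    (hne : ∀ i, (B i).toSubmodule ≠ ⊥)
    (hdim : Module.finrank ℂ (IntertwiningMap ρ ρ) ≤ Fintype.card ι)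
    (f : IntertwiningMap ρ ρ) :
    ∃ c : ι → ℂ, f = ∑ i, c i • projIntertwining hρ (B i) := by
  have hli : LinearIndependent ℂ fun i => projIntertwining hρ (B i) := by
    rw [Fintype.linearIndependent_iff]
    intro c hc j
    obtain ⟨v, hv, hv0⟩ := Submodule.exists_mem_ne_zero_of_ne_bot (hne j)
    have := sum_projIntertwining_apply_of_mem hρ horth c hv
    rw [hc] at this
    exact (smul_eq_zero.1 this.symm).resolve_right hv0
  -- Independence bounds the number of blocks by the dimension of the commutant, and `hdim` is the
  -- opposite inequality.
  have hspan := hli.span_eq_top_of_card_eq_finrank' (hli.fintype_card_le_finrank.antisymm hdim)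
  have hf : f ∈ Submodule.span ℂ (Set.range fun i => projIntertwining hρ (B i)) := by
    rw [hspan]; trivial
  obtain ⟨c, hc⟩ := (Submodule.mem_span_range_iff_exists_fun ℂ).1 hf
  exact ⟨c, hc.symm⟩

/-- A vector orthogonal to all the blocks vanishes. -/
theorem eq_zero_of_forall_mem_orthogonal
    (hρ : ∀ g u v, inner ℂ (ρ g u) (ρ g v) = inner ℂ u v)
    (horth : ∀ i j, i ≠ j → (B i).toSubmodule ⟂ (B j).toSubmodule)
    (hne : ∀ i, (B i).toSubmodule ≠ ⊥)
    (hdim : Module.finrank ℂ (IntertwiningMap ρ ρ) ≤ Fintype.card ι) {v : E}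
    (hv : ∀ i, v ∈ (B i).toSubmoduleᗮ) : v = 0 := by
  -- The identity is a combination of the block projections, and each of these kills `v`.
  obtain ⟨c, hc⟩ := exists_eq_sum_projIntertwining hρ horth hne hdim (IntertwiningMap.id ρ)
  have h : IntertwiningMap.id ρ v = v := rfl
  rw [← h, hc, IntertwiningMap.sum_apply]
  refine Finset.sum_eq_zero fun i _ => ?_
  rw [IntertwiningMap.smul_apply, projIntertwining_apply,
    (Submodule.starProjection_apply_eq_zero_iff _).2 (hv i), smul_zero]

theorem isInternal_of_finrank_commutant_le [DecidableEq ι]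
    (hρ : ∀ g u v, inner ℂ (ρ g u) (ρ g v) = inner ℂ u v)
    (horth : ∀ i j, i ≠ j → (B i).toSubmodule ⟂ (B j).toSubmodule)
    (hne : ∀ i, (B i).toSubmodule ≠ ⊥)
    (hdim : Module.finrank ℂ (IntertwiningMap ρ ρ) ≤ Fintype.card ι) :
    DirectSum.IsInternal fun i => (B i).toSubmodule := by
  have hO : OrthogonalFamily ℂ (fun i => (B i).toSubmodule)
      fun i => (B i).toSubmodule.subtypeₗᵢ :=
    OrthogonalFamily.of_pairwise fun i j hij => horth i j hij
  rw [hO.isInternal_iff, Submodule.eq_bot_iff]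
  intro v hv
  exact eq_zero_of_forall_mem_orthogonal hρ horth hne hdim fun i =>
    Submodule.orthogonal_le (le_iSup (fun i => (B i).toSubmodule) i) hv

/-- A nonzero invariant subspace of a block is the whole block. -/
theorem le_of_le_block
    (hρ : ∀ g u v, inner ℂ (ρ g u) (ρ g v) = inner ℂ u v)
    (horth : ∀ i j, i ≠ j → (B i).toSubmodule ⟂ (B j).toSubmodule)
    (hne : ∀ i, (B i).toSubmodule ≠ ⊥)
    (hdim : Module.finrank ℂ (IntertwiningMap ρ ρ) ≤ Fintype.card ι) (j : ι)
    (W : Subrepresentation ρ) (hW : W.toSubmodule ≤ (B j).toSubmodule)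
    (hW0 : W.toSubmodule ≠ ⊥) : (B j).toSubmodule ≤ W.toSubmodule := by
  -- The projection onto `W` acts on the block as a scalar. It fixes a nonzero vector of `W`, so the
  -- scalar is `1` and the whole block lies in `W`.
  obtain ⟨c, hc⟩ := exists_eq_sum_projIntertwining hρ horth hne hdim (projIntertwining hρ W)
  have key : ∀ v ∈ (B j).toSubmodule, W.toSubmodule.starProjection v = c j • v := by
    intro v hv
    rw [← projIntertwining_apply hρ, hc, sum_projIntertwining_apply_of_mem hρ horth c hv]
  obtain ⟨w, hw, hw0⟩ := Submodule.exists_mem_ne_zero_of_ne_bot hW0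
  have h1 : c j = 1 := by
    have := key w (hW hw)
    rw [Submodule.starProjection_eq_self_iff.2 hw] at this
    by_contra hne1
    have h2 : (1 - c j) • w = 0 := by rw [sub_smul, one_smul, ← this, sub_self]
    exact (smul_eq_zero.1 h2).elim (fun h => hne1 (sub_eq_zero.1 h).symm) hw0
  intro v hv
  have := key v hv
  rw [h1, one_smul] at this
  exact Submodule.starProjection_eq_self_iff.1 this

theorem isIrreducible_of_finrank_commutant_le
    (hρ : ∀ g u v, inner ℂ (ρ g u) (ρ g v) = inner ℂ u v)
    (horth : ∀ i j, i ≠ j → (B i).toSubmodule ⟂ (B j).toSubmodule)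
    (hne : ∀ i, (B i).toSubmodule ≠ ⊥)
    (hdim : Module.finrank ℂ (IntertwiningMap ρ ρ) ≤ Fintype.card ι) (j : ι) :
    (B j).toRepresentation.IsIrreducible := by
  have hnt : Nontrivial (Subrepresentation (B j).toRepresentation) := by
    obtain ⟨v, hv, hv0⟩ := Submodule.exists_mem_ne_zero_of_ne_bot (hne j)
    refine ⟨⟨⊥, ⊤, fun h => hv0 ?_⟩⟩
    have h2 : (⟨v, hv⟩ : (B j).toSubmodule) ∈
        (⊤ : Subrepresentation (B j).toRepresentation).toSubmodule := Submodule.mem_top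
    rw [← h] at h2
    exact congrArg Subtype.val ((Submodule.mem_bot ℂ).1 h2)
  refine ⟨fun W => ?_⟩
  let W' : Subrepresentation ρ :=
    { toSubmodule := W.toSubmodule.map (B j).toSubmodule.subtype
      apply_mem_toSubmodule := by
        rintro g _ ⟨w, hw, rfl⟩
        exact ⟨_, W.apply_mem_toSubmodule g hw, rfl⟩ }
  by_cases h0 : W'.toSubmodule = ⊥
  · left
    apply Subrepresentation.toSubmodule_injective
    exact (Submodule.map_injective_of_injective (Submodule.subtype_injective _))
      (h0.trans (Submodule.map_bot _).symm)
  · right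
    apply Subrepresentation.toSubmodule_injective
    refine (Submodule.eq_top_iff'.2 fun x => ?_)
    obtain ⟨w, hw, hwx⟩ := le_of_le_block hρ horth hne hdim j W'
      (Submodule.map_subtype_le _ _) h0 x.2
    rwa [← Subtype.ext hwx]

/-- An isomorphism of two blocks, precomposed with a projection, would be an intertwiner that moves
one block into another, whereas combinations of the projections preserve every block. -/
theorem isEmpty_equiv_of_finrank_commutant_le
    (hρ : ∀ g u v, inner ℂ (ρ g u) (ρ g v) = inner ℂ u v)
    (horth : ∀ i j, i ≠ j → (B i).toSubmodule ⟂ (B j).toSubmodule)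
    (hne : ∀ i, (B i).toSubmodule ≠ ⊥)
    (hdim : Module.finrank ℂ (IntertwiningMap ρ ρ) ≤ Fintype.card ι) (i j : ι) (hij : i ≠ j) :
    IsEmpty ((B i).toRepresentation.Equiv (B j).toRepresentation) := by
  refine ⟨fun e => ?_⟩
  let f : IntertwiningMap ρ ρ :=
    { toLinearMap := (B j).toSubmodule.subtype ∘ₗ e.toLinearMap ∘ₗ
        ((B i).toSubmodule.orthogonalProjectionOnto).toLinearMap
      isIntertwining' := by
        intro g
        ext v
        have h1 : (B i).toSubmodule.orthogonalProjectionOnto (ρ g v) =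
            (B i).toRepresentation g ((B i).toSubmodule.orthogonalProjectionOnto v) :=
          Subtype.ext (starProjection_comm_of_unitary hρ (B i) g v)
        have h2 := IntertwiningMap.isIntertwining _ _ e.toIntertwiningMap g
          ((B i).toSubmodule.orthogonalProjectionOnto v)
        exact (congrArg (fun x => (e x : E)) h1).trans (congrArg Subtype.val h2) }
  obtain ⟨c, hc⟩ := exists_eq_sum_projIntertwining hρ horth hne hdim f
  obtain ⟨v, hv, hv0⟩ := Submodule.exists_mem_ne_zero_of_ne_bot (hne i)
  have h1 : f v = (e ⟨v, hv⟩ : E) := by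
    have : (B i).toSubmodule.orthogonalProjectionOnto v = ⟨v, hv⟩ :=
      Submodule.orthogonalProjectionOnto_mem_subspace_eq_self (⟨v, hv⟩ : (B i).toSubmodule)
    exact congrArg (fun x => (e x : E)) this
  have h2 : f v = c i • v := by rw [hc, sum_projIntertwining_apply_of_mem hρ horth c hv]
  have h3 : (e ⟨v, hv⟩ : E) = 0 := by
    have := (horth i j hij)
    have h4 : (e ⟨v, hv⟩ : E) ∈ (B i).toSubmodule := by
      rw [← h1, h2]; exact Submodule.smul_mem _ _ hv
    exact Submodule.disjoint_def.1 this.disjoint _ h4 (e ⟨v, hv⟩).2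
  have h4 : e ⟨v, hv⟩ = 0 := Subtype.ext h3
  have h5 := e.toLinearEquiv.map_eq_zero_iff.1 h4
  exact hv0 (congrArg Subtype.val h5)

/-- A symmetric operator commuting with the action is a real combination of the projections onto
the blocks, and the coefficients are eigenvalues. -/
theorem exists_eq_sum_starProjection_of_isSymmetric
    (hρ : ∀ g u v, inner ℂ (ρ g u) (ρ g v) = inner ℂ u v)
    (horth : ∀ i j, i ≠ j → (B i).toSubmodule ⟂ (B j).toSubmodule)
    (hne : ∀ i, (B i).toSubmodule ≠ ⊥)
    (hdim : Module.finrank ℂ (IntertwiningMap ρ ρ) ≤ Fintype.card ι) (A : E →L[ℂ] E)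
    (hA : A.toLinearMap.IsSymmetric) (hcomm : ∀ g v, A (ρ g v) = ρ g (A v)) :
    ∃ α : ι → ℝ, A = ∑ j, (α j : ℂ) • (B j).toSubmodule.starProjection ∧
      ∀ j, Module.End.HasEigenvalue A.toLinearMap (α j : ℂ) := by
  let f : IntertwiningMap ρ ρ :=
    { toLinearMap := A.toLinearMap
      isIntertwining' := fun g => LinearMap.ext fun v => hcomm g v }
  have hf (v : E) : f v = A v := rfl
  obtain ⟨c, hc⟩ := exists_eq_sum_projIntertwining hρ horth hne hdim f
  have heig (j : ι) : Module.End.HasEigenvalue A.toLinearMap (c j) := by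
    obtain ⟨v, hv, hv0⟩ := Submodule.exists_mem_ne_zero_of_ne_bot (hne j)
    refine Module.End.hasEigenvalue_of_hasEigenvector (x := v)
      ⟨Module.End.mem_eigenspace_iff.2 ?_, hv0⟩
    rw [ContinuousLinearMap.coe_coe, ← hf, hc, sum_projIntertwining_apply_of_mem hρ horth c hv]
  have hreal (j : ι) : ((c j).re : ℂ) = c j :=
    Complex.conj_eq_iff_re.1 (hA.conj_eigenvalue_eq_self (heig j))
  refine ⟨fun j => (c j).re, ContinuousLinearMap.ext fun v => ?_, fun j => by
    rw [hreal]; exact heig j⟩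
  simp only [hreal]
  rw [← hf, hc, IntertwiningMap.sum_apply, _root_.sum_apply]
  rfl

end OrthogonalDecomposition

/-! ### The commutant of `H_l` and the distance operators. -/

section WeightSpace

open Representation

variable {n l : ℕ}

theorem weightRep_apply_coe (g : Equiv.Perm (Fin n)) (v : weightSpace n l) (z : Fin n → Fin 2) :
    (weightRep n l g v : QubitSpace n) z = (v : QubitSpace n) (z ∘ g) := rfl

theorem weightKet_apply (y : {x : Fin n → Fin 2 // hammingNorm x = l}) (z : Fin n → Fin 2) :
    (weightKet y : QubitSpace n) z = if z = y.1 then 1 else 0 := by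
  simp [weightKet, ket]

/-- The permutation of the strings of weight `l` induced by a permutation of the positions. -/
def weightPerm (l : ℕ) (g : Equiv.Perm (Fin n)) :
    {x : Fin n → Fin 2 // hammingNorm x = l} ≃ {x : Fin n → Fin 2 // hammingNorm x = l} where
  toFun x := ⟨x.1 ∘ g.symm, (hammingNorm_comp_perm _ _).trans x.2⟩
  invFun x := ⟨x.1 ∘ g, (hammingNorm_comp_perm _ _).trans x.2⟩
  left_inv x := by ext; simp
  right_inv x := by ext; simp

theorem weightRep_weightKet (g : Equiv.Perm (Fin n))
    (y : {x : Fin n → Fin 2 // hammingNorm x = l}) :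
    weightRep n l g (weightKet y) = weightKet (weightPerm l g y) :=
  Subtype.ext (permRep_ket g y.1)

theorem sum_smul_weightKet (v : weightSpace n l) :
    ∑ y : {x : Fin n → Fin 2 // hammingNorm x = l}, (v : QubitSpace n) y.1 • weightKet y = v := by
  obtain ⟨v, hv⟩ := v
  refine Subtype.ext ?_
  simp only [Submodule.coe_sum, Submodule.coe_smul]
  induction hv using Submodule.span_induction with
  | mem v h =>
    obtain ⟨x, hx, rfl⟩ := h
    rw [Finset.sum_eq_single ⟨x, hx⟩]
    · simp [ket, weightKet]
    · intro b _ hb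
      have : ¬ b.1 = x := fun h => hb (Subtype.ext h)
      simp [ket, this]
    · simp
  | zero => simp
  | add u v _ _ hu hv =>
    simp only [PiLp.add_apply, add_smul, Finset.sum_add_distrib, hu, hv]
  | smul a v _ hv =>
    simp only [PiLp.smul_apply, smul_eq_mul, mul_smul, ← Finset.smul_sum, hv]

theorem weightSpace_inner (u v : weightSpace n l) :
    inner ℂ u v = ∑ z, inner ℂ ((u : QubitSpace n) z) ((v : QubitSpace n) z) := by
  rw [Submodule.coe_inner, PiLp.inner_apply]

theorem weightSpace_sum_inner {ι : Type*} (s : Finset ι) (f : ι → weightSpace n l)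
    (v : weightSpace n l) : inner ℂ (∑ i ∈ s, f i) v = ∑ i ∈ s, inner ℂ (f i) v :=
  sum_inner (𝕜 := ℂ) (E := weightSpace n l) s f v

theorem weightSpace_inner_sum {ι : Type*} (s : Finset ι) (f : ι → weightSpace n l)
    (v : weightSpace n l) : inner ℂ v (∑ i ∈ s, f i) = ∑ i ∈ s, inner ℂ v (f i) :=
  inner_sum (𝕜 := ℂ) (E := weightSpace n l) s f v

theorem weightSpace_inner_smul_left (a : ℂ) (u v : weightSpace n l) :
    inner ℂ (a • u) v = starRingEnd ℂ a * inner ℂ u v :=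
  inner_smul_left (𝕜 := ℂ) (E := weightSpace n l) u v a

theorem weightSpace_inner_smul_right (a : ℂ) (u v : weightSpace n l) :
    inner ℂ u (a • v) = a * inner ℂ u v :=
  inner_smul_right (𝕜 := ℂ) (E := weightSpace n l) u v a

theorem weightRep_inner (g : Equiv.Perm (Fin n)) (u v : weightSpace n l) :
    inner ℂ (weightRep n l g u) (weightRep n l g v) = inner ℂ u v := by
  rw [weightSpace_inner, weightSpace_inner]
  exact Equiv.sum_comp (g.symm.arrowCongr (Equiv.refl (Fin 2)))
    fun z => inner ℂ ((u : QubitSpace n) z) ((v : QubitSpace n) z)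

theorem hammingDist_comp_perm (x y : Fin n → Fin 2) (g : Equiv.Perm (Fin n)) :
    hammingDist (x ∘ g) (y ∘ g) = hammingDist x y := by
  unfold hammingDist
  exact Finset.card_equiv g (by simp)

/-- These relations determine how often each pair of bits occurs from `n`, the two weights and the
distance. -/
theorem card_pair_counts (x y : Fin n → Fin 2) :
    (Finset.univ.filter fun i => (x i, y i) = (1, 0)).card +
      (Finset.univ.filter fun i => (x i, y i) = (1, 1)).card = hammingNorm x ∧
    (Finset.univ.filter fun i => (x i, y i) = (0, 1)).card +
      (Finset.univ.filter fun i => (x i, y i) = (1, 1)).card = hammingNorm y ∧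
    (Finset.univ.filter fun i => (x i, y i) = (1, 0)).card +
      (Finset.univ.filter fun i => (x i, y i) = (0, 1)).card = hammingDist x y ∧
    (Finset.univ.filter fun i => (x i, y i) = (0, 0)).card +
      (Finset.univ.filter fun i => (x i, y i) = (0, 1)).card + hammingNorm x = n := by
  have hn : n = ∑ _i : Fin n, 1 := by simp
  unfold hammingNorm hammingDist
  simp only [Finset.card_filter, ← Finset.sum_add_distrib]
  refine ⟨Finset.sum_congr rfl fun i _ => ?_, Finset.sum_congr rfl fun i _ => ?_,
    Finset.sum_congr rfl fun i _ => ?_, (Finset.sum_congr rfl fun i _ => ?_).trans hn.symm⟩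
  all_goals
    obtain hx | hx : x i = 0 ∨ x i = 1 := by omega
    all_goals
      obtain hy | hy : y i = 0 ∨ y i = 1 := by omega
      all_goals simp [hx, hy]

/-- The distance of two strings of equal weight is even and at most `2 * min l (n - l)`. -/
theorem exists_hammingDist_eq (x y : {x : Fin n → Fin 2 // hammingNorm x = l}) :
    ∃ k : Fin (min l (n - l) + 1), hammingDist x.1 y.1 = 2 * k := by
  obtain ⟨h1, h2, h3, h4⟩ := card_pair_counts x.1 y.1
  rw [x.2] at h1 h4
  rw [y.2] at h2
  -- Equal weights force as many positions `(1, 0)` as `(0, 1)`; the former lie among the `l` ones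
  -- of `x`, the latter among its `n - l` zeros.
  refine ⟨⟨(Finset.univ.filter fun i => (x.1 i, y.1 i) = (1, 0)).card, ?_⟩, ?_⟩
  · omega
  · simp only
    omega

/-- Pairs of strings of equal weight at the same distance are in the same orbit. -/
theorem exists_perm_of_hammingDist_eq {x y x' y' : {x : Fin n → Fin 2 // hammingNorm x = l}}
    (h : hammingDist x.1 y.1 = hammingDist x'.1 y'.1) :
    ∃ g : Equiv.Perm (Fin n), weightPerm l g x = x' ∧ weightPerm l g y = y' := by
  -- A permutation carrying one pair of strings to the other exists as soon as every pair of bits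
  -- occurs equally often in both.
  have hfib (c : Fin 2 × Fin 2) : Nonempty
      ({i // (fun i => (x.1 i, y.1 i)) i = c} ≃ {i // (fun i => (x'.1 i, y'.1 i)) i = c}) := by
    rw [← Fintype.card_eq, Fintype.card_subtype, Fintype.card_subtype]
    obtain ⟨h1, h2, h3, h4⟩ := card_pair_counts x.1 y.1
    obtain ⟨h1', h2', h3', h4'⟩ := card_pair_counts x'.1 y'.1
    rw [x.2] at h1 h4
    rw [y.2] at h2
    rw [x'.2] at h1' h4'
    rw [y'.2] at h2'
    fin_cases c <;> simp only [Fin.zero_eta, Fin.mk_one] <;> omega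
  let g : Equiv.Perm (Fin n) := Equiv.ofFiberEquiv fun c => (hfib c).some
  have hg (i : Fin n) : (x'.1 (g i), y'.1 (g i)) = (x.1 i, y.1 i) :=
    Equiv.ofFiberEquiv_map (fun c => (hfib c).some) i
  refine ⟨g, Subtype.ext (funext fun i => ?_), Subtype.ext (funext fun i => ?_)⟩
  · simpa [weightPerm] using (congrArg Prod.fst (hg (g.symm i))).symm
  · simpa [weightPerm] using (congrArg Prod.snd (hg (g.symm i))).symm

/-- The matrix entries of an intertwining map of `H_l` are constant on orbits. -/
theorem intertwining_entry_weightPerm (f : IntertwiningMap (weightRep n l) (weightRep n l))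
    (g : Equiv.Perm (Fin n)) (x y : {x : Fin n → Fin 2 // hammingNorm x = l}) :
    (f (weightKet (weightPerm l g y)) : QubitSpace n) (weightPerm l g x).1 =
      (f (weightKet y) : QubitSpace n) x.1 := by
  rw [← weightRep_weightKet, IntertwiningMap.isIntertwining, weightRep_apply_coe]
  exact congrArg (f (weightKet y) : QubitSpace n) (funext fun i => by simp [weightPerm])

/-- The sums of the matrix entries of an intertwining map of `H_l` over the pairs of strings of
given distance. -/
noncomputable def orbitSums (n l : ℕ) :
    IntertwiningMap (weightRep n l) (weightRep n l) →ₗ[ℂ] (Fin (min l (n - l) + 1) → ℂ) where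
  toFun f k := ∑ p : {x : Fin n → Fin 2 // hammingNorm x = l} ×
    {x : Fin n → Fin 2 // hammingNorm x = l} with hammingDist p.1.1 p.2.1 = 2 * k,
      (f (weightKet p.2) : QubitSpace n) p.1.1
  map_add' f g := by
    ext k
    simp [Finset.sum_add_distrib]
  map_smul' a f := by
    ext k
    simp [Finset.mul_sum]

/-- The entries in one orbit are all equal, so an orbit sum is an entry times the size of a nonempty
orbit, and it vanishes only if the entry does. -/
theorem orbitSums_injective (n l : ℕ) : Function.Injective (orbitSums n l) := by
  rw [← LinearMap.ker_eq_bot, LinearMap.ker_eq_bot']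
  intro f hf
  have hent (x y : {x : Fin n → Fin 2 // hammingNorm x = l}) :
      (f (weightKet y) : QubitSpace n) x.1 = 0 := by
    obtain ⟨k, hk⟩ := exists_hammingDist_eq x y
    have h := congrFun hf k
    have hconst : orbitSums n l f k = ∑ p : {x : Fin n → Fin 2 // hammingNorm x = l} ×
        {x : Fin n → Fin 2 // hammingNorm x = l} with hammingDist p.1.1 p.2.1 = 2 * k,
        (f (weightKet y) : QubitSpace n) x.1 := by
      refine Finset.sum_congr rfl fun p hp => ?_
      rw [Finset.mem_filter] at hp
      obtain ⟨g, hg1, hg2⟩ := exists_perm_of_hammingDist_eq (hk.trans hp.2.symm)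
      rw [← hg1, ← hg2, intertwining_entry_weightPerm]
    rw [hconst, Finset.sum_const, Pi.zero_apply, smul_eq_zero] at h
    refine h.resolve_left fun h0 => ?_
    rw [Finset.card_eq_zero] at h0
    exact Finset.notMem_empty (x, y) (h0 ▸ Finset.mem_filter.2 ⟨Finset.mem_univ _, hk⟩)
  refine IntertwiningMap.ext (LinearMap.ext fun v => ?_)
  have hket (y : {x : Fin n → Fin 2 // hammingNorm x = l}) : f.toLinearMap (weightKet y) = 0 := by
    refine (sum_smul_weightKet _).symm.trans (Finset.sum_eq_zero fun x _ => ?_)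
    rw [IntertwiningMap.toLinearMap_apply, hent, zero_smul]
  rw [← sum_smul_weightKet v, map_sum]
  refine (Finset.sum_eq_zero fun y _ => ?_).trans (LinearMap.zero_apply _).symm
  rw [map_smul, hket, smul_zero]

theorem finrank_intertwiningMap_weightRep_le (n l : ℕ) :
    Module.finrank ℂ (IntertwiningMap (weightRep n l) (weightRep n l)) ≤ min l (n - l) + 1 := by
  refine (LinearMap.finrank_le_finrank_of_injective (orbitSums_injective n l)).trans ?_
  simp

theorem distanceOperator_apply (k : ℕ) (v : weightSpace n l) :
    distanceOperator n l k v = ∑ x : {x : Fin n → Fin 2 // hammingNorm x = l},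
      ∑ y : {x : Fin n → Fin 2 // hammingNorm x = l},
        if hammingDist x.1 y.1 = 2 * k then inner ℂ (weightKet y) v • weightKet x else 0 := by
  rw [distanceOperator, _root_.sum_apply]
  refine Finset.sum_congr rfl fun x _ => ?_
  rw [_root_.sum_apply]
  refine Finset.sum_congr rfl fun y _ => ?_
  split_ifs
  · rfl
  · rfl

theorem distanceOperator_comm (k : ℕ) (g : Equiv.Perm (Fin n)) (v : weightSpace n l) :
    distanceOperator n l k (weightRep n l g v) = weightRep n l g (distanceOperator n l k v) := by
  rw [distanceOperator_apply, distanceOperator_apply, map_sum,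
    ← Equiv.sum_comp (weightPerm l g)]
  refine Finset.sum_congr rfl fun x _ => ?_
  rw [map_sum, ← Equiv.sum_comp (weightPerm l g)]
  refine Finset.sum_congr rfl fun y _ => ?_
  have hd : hammingDist (weightPerm l g x).1 (weightPerm l g y).1 = hammingDist x.1 y.1 :=
    hammingDist_comp_perm x.1 y.1 g.symm
  rw [hd, ← weightRep_weightKet, ← weightRep_weightKet, weightRep_inner]
  split_ifs
  · rw [map_smul]
  · rw [map_zero]

/-- Taking adjoints exchanges `x` and `y` in every summand, and the distance is symmetric. -/
theorem distanceOperator_isSymmetric (n l k : ℕ) :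
    LinearMap.IsSymmetric (𝕜 := ℂ) (E := weightSpace n l)
      (distanceOperator n l k).toLinearMap := by
  intro u v
  change inner ℂ (distanceOperator n l k u) v = inner ℂ u (distanceOperator n l k v)
  rw [distanceOperator_apply, distanceOperator_apply, weightSpace_sum_inner, weightSpace_inner_sum]
  simp only [weightSpace_sum_inner, weightSpace_inner_sum]
  rw [Finset.sum_comm]
  refine Finset.sum_congr rfl fun x _ => Finset.sum_congr rfl fun y _ => ?_
  rw [hammingDist_comm]
  split_ifs
  · rw [weightSpace_inner_smul_left, weightSpace_inner_smul_right, mul_comm]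
    exact congrArg _ (inner_conj_symm (𝕜 := ℂ) (E := weightSpace n l) _ _)
  · exact (inner_zero_left (𝕜 := ℂ) (E := weightSpace n l) v).trans
      (inner_zero_right (𝕜 := ℂ) (E := weightSpace n l) u).symm

end WeightSpace

/-! ### Polytabloids of two-row shape inside `H_l`. -/

section TwoRowTableaux

open Representation YoungTableau

variable {n l : ℕ} {μ : YoungDiagram}

namespace YoungTableau

/-- The tableau obtained by applying a permutation to the entries. -/
def relabel (T : YoungTableau n μ) (g : Equiv.Perm (Fin n)) : YoungTableau n μ := g.symm.trans T

theorem row_relabel (T : YoungTableau n μ) (g : Equiv.Perm (Fin n)) (i : Fin n) :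
    (T.relabel g).row i = T.row (g.symm i) := rfl

theorem col_relabel (T : YoungTableau n μ) (g : Equiv.Perm (Fin n)) (i : Fin n) :
    (T.relabel g).col i = T.col (g.symm i) := rfl

theorem exists_eq_relabel (T T' : YoungTableau n μ) : ∃ g, T' = T.relabel g :=
  ⟨T.trans T'.symm, Equiv.ext fun i => by simp [relabel]⟩

theorem mem_rowStabilizer {T : YoungTableau n μ} {σ : Equiv.Perm (Fin n)} :
    σ ∈ T.rowStabilizer ↔ ∀ i, T.row (σ i) = T.row i := by
  simp [rowStabilizer]

theorem mem_colStabilizer {T : YoungTableau n μ} {σ : Equiv.Perm (Fin n)} :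
    σ ∈ T.colStabilizer ↔ ∀ i, T.col (σ i) = T.col i := by
  simp [colStabilizer]

theorem ext_row_col (T : YoungTableau n μ) {i k : Fin n} (hr : T.row i = T.row k)
    (hc : T.col i = T.col k) : i = k :=
  T.injective (Subtype.ext (Prod.ext hr hc))

end YoungTableau

theorem mem_twoRowDiagram {n j : ℕ} {h : 2 * j ≤ n} {a b : ℕ} :
    (a, b) ∈ (twoRowDiagram n j h).cells ↔ (a = 0 ∧ b < n - j) ∨ (a = 1 ∧ b < j) := by
  rw [YoungDiagram.mem_cells, twoRowDiagram, YoungDiagram.mem_ofRowLens]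
  rcases a with _ | _ | a <;> simp

theorem row_col_twoRow {j : ℕ} {h : 2 * j ≤ n} (T : YoungTableau n (twoRowDiagram n j h))
    (i : Fin n) : (T.row i = 0 ∧ T.col i < n - j) ∨ (T.row i = 1 ∧ T.col i < j) :=
  mem_twoRowDiagram.1 (T i).2

theorem exists_entry_of_mem {j : ℕ} {h : 2 * j ≤ n} (T : YoungTableau n (twoRowDiagram n j h))
    {a b : ℕ} (hab : (a = 0 ∧ b < n - j) ∨ (a = 1 ∧ b < j)) : ∃ i, T.row i = a ∧ T.col i = b :=
  ⟨T.symm ⟨(a, b), mem_twoRowDiagram.2 hab⟩, by simp [row], by simp [col]⟩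

/-- The second row of a tableau of shape `(n - j, j)` has `j` entries. -/
theorem card_secondRow {j : ℕ} {h : 2 * j ≤ n} (T : YoungTableau n (twoRowDiagram n j h)) :
    (Finset.univ.filter fun i => T.row i = 1).card = j := by
  refine Eq.trans ?_ (Finset.card_range j)
  refine Finset.card_bij (fun i _ => T.col i) ?_ ?_ ?_
  · intro i hi
    have := row_col_twoRow T i
    simp at hi ⊢
    omega
  · intro i hi k hk hik
    simp at hi hk
    exact T.ext_row_col (hi.trans hk.symm) hik
  · intro c hc
    obtain ⟨i, hi, hic⟩ := exists_entry_of_mem T (Or.inr ⟨rfl, Finset.mem_range.1 hc⟩)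
    exact ⟨i, by simpa using hi, hic⟩

/-- The sum of the basis vectors `|y⟩` of `H_l` with `y` equal to one on the second row of `T`. -/
noncomputable def rowVector (l : ℕ) (T : YoungTableau n μ) : weightSpace n l :=
  ∑ y : {x : Fin n → Fin 2 // hammingNorm x = l} with ∀ i, T.row i = 1 → y.1 i = 1, weightKet y

open Classical in
theorem rowVector_apply (T : YoungTableau n μ) (z : Fin n → Fin 2) :
    (rowVector l T : QubitSpace n) z =
      if hammingNorm z = l ∧ ∀ i, T.row i = 1 → z i = 1 then 1 else 0 := by
  rw [rowVector, Submodule.coe_sum, WithLp.ofLp_sum, Finset.sum_apply]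
  simp only [weightKet_apply]
  split_ifs with hz
  · rw [Finset.sum_eq_single ⟨z, hz.1⟩]
    · simp
    · intro b _ hb
      exact if_neg fun h => hb (Subtype.ext h.symm)
    · intro hb
      exact absurd (Finset.mem_filter.2 ⟨Finset.mem_univ _, hz.2⟩) hb
  · refine Finset.sum_eq_zero fun b hb => if_neg ?_
    rintro rfl
    exact hz ⟨b.2, (Finset.mem_filter.1 hb).2⟩

theorem weightSpace_ext {u v : weightSpace n l}
    (h : ∀ z, (u : QubitSpace n) z = (v : QubitSpace n) z) : u = v :=
  Subtype.ext (PiLp.ext h)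

theorem rowVector_congr {T T' : YoungTableau n μ} (h : ∀ i, T.row i = 1 ↔ T'.row i = 1) :
    rowVector l T = rowVector l T' := by
  simp only [rowVector, h]

theorem weightRep_rowVector (g : Equiv.Perm (Fin n)) (T : YoungTableau n μ) :
    weightRep n l g (rowVector l T) = rowVector l (T.relabel g) := by
  refine weightSpace_ext fun z => ?_
  rw [weightRep_apply_coe, rowVector_apply, rowVector_apply, hammingNorm_comp_perm]
  congr 2
  refine propext ⟨fun h i hi => ?_, fun h i hi => ?_⟩
  · simpa using h (g.symm i) hi
  · exact h (g i) (by simpa [row_relabel] using hi)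

/-- The image of `rowVector l T` under the product of the column antisymmetrizers of `T`. -/
noncomputable def polytabloid (l : ℕ) (T : YoungTableau n μ) : weightSpace n l :=
  ∑ σ ∈ T.colStabilizer,
    ((Equiv.Perm.sign σ : ℤ) : ℂ) • weightRep n l σ (rowVector l T)

/-- Relabelling by `g` conjugates the column stabilizer by `g`, and conjugation preserves signs. -/
theorem weightRep_polytabloid (g : Equiv.Perm (Fin n)) (T : YoungTableau n μ) :
    weightRep n l g (polytabloid l T) = polytabloid l (T.relabel g) := by
  rw [polytabloid, polytabloid, map_sum]
  refine Finset.sum_equiv (MulAut.conj g).toEquiv (fun σ => ?_) fun σ _ => ?_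
  · simp only [mem_colStabilizer, col_relabel]
    refine ⟨fun h i => ?_, fun h i => ?_⟩
    · simpa using h (g.symm i)
    · simpa using h (g i)
  · rw [map_smul, ← weightRep_rowVector, ← Module.End.mul_apply, ← Module.End.mul_apply,
      ← map_mul, ← map_mul]
    have hs : Equiv.Perm.sign ((MulAut.conj g).toEquiv σ) = Equiv.Perm.sign σ :=
      by simp [Equiv.Perm.sign_mul, mul_comm, ← mul_assoc]
    rw [hs]
    simp

theorem weightRep_polytabloid_of_mem {T : YoungTableau n μ} {τ : Equiv.Perm (Fin n)}
    (hτ : τ ∈ T.colStabilizer) :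
    weightRep n l τ (polytabloid l T) = ((Equiv.Perm.sign τ : ℤ) : ℂ) • polytabloid l T := by
  rw [polytabloid, map_sum, Finset.smul_sum]
  refine Finset.sum_equiv (Equiv.mulLeft τ) (fun σ => ?_) fun σ _ => ?_
  · rw [mem_colStabilizer] at hτ
    simp [mem_colStabilizer, hτ]
  · rw [map_smul, ← Module.End.mul_apply, ← map_mul, smul_smul]
    congr 1
    rcases Int.units_eq_one_or (Equiv.Perm.sign τ) with h | h <;>
      simp [Equiv.Perm.sign_mul, h]

/-- The span of the polytabloids of shape `μ` in `H_l`. -/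
noncomputable def spechtSubrep (n l : ℕ) (μ : YoungDiagram) :
    Subrepresentation (weightRep n l) where
  toSubmodule := Submodule.span ℂ (Set.range (polytabloid l : YoungTableau n μ → weightSpace n l))
  apply_mem_toSubmodule g v hv := by
    refine (Submodule.span_le.2 ?_ : _ ≤ (Submodule.span ℂ (Set.range
      (polytabloid l : YoungTableau n μ → weightSpace n l))).comap (weightRep n l g)) hv
    rintro _ ⟨T, rfl⟩
    exact Submodule.subset_span ⟨T.relabel g, (weightRep_polytabloid g T).symm⟩

theorem polytabloid_mem (l : ℕ) (T : YoungTableau n μ) :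
    polytabloid l T ∈ (spechtSubrep n l μ).toSubmodule :=
  Submodule.subset_span ⟨T, rfl⟩

/-- If the second row of `T` is shorter than that of `T'`, then some column of `T'` of length two
avoids it, and the antisymmetry in that column gives orthogonality. -/
theorem inner_rowVector_polytabloid {i j : ℕ} {hi : 2 * i ≤ n} {hj : 2 * j ≤ n} (hij : i < j)
    (T : YoungTableau n (twoRowDiagram n i hi)) (T' : YoungTableau n (twoRowDiagram n j hj)) :
    inner ℂ (rowVector l T) (polytabloid l T') = 0 := by
  -- Pigeonhole: the `i` second-row entries of `T` meet at most `i < j` columns of `T'`. Swapping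
  -- the two entries of a column they miss fixes `rowVector l T` and negates the polytabloid.
  obtain ⟨c, hc, hc'⟩ := Finset.exists_mem_notMem_of_card_lt_card
    (s := (Finset.univ.filter fun e => T.row e = 1).image T'.col) (t := Finset.range j)
    (Finset.card_image_le.trans_lt (by rwa [card_secondRow, Finset.card_range]))
  rw [Finset.mem_range] at hc
  obtain ⟨p, hp, hpc⟩ := exists_entry_of_mem T' (Or.inl ⟨rfl, (by omega : c < n - j)⟩)
  obtain ⟨q, hq, hqc⟩ := exists_entry_of_mem T' (Or.inr ⟨rfl, hc⟩)
  have hTc (e : Fin n) (he : T'.col e = c) : T.row e ≠ 1 := fun h =>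
    hc' (Finset.mem_image.2 ⟨e, Finset.mem_filter.2 ⟨Finset.mem_univ _, h⟩, he⟩)
  have hpq : p ≠ q := by rintro rfl; omega
  have hmem : Equiv.swap p q ∈ T'.colStabilizer := by
    refine mem_colStabilizer.2 fun e => ?_
    by_cases h1 : e = p
    · rw [h1, Equiv.swap_apply_left, hpc, hqc]
    by_cases h2 : e = q
    · rw [h2, Equiv.swap_apply_right, hpc, hqc]
    rw [Equiv.swap_apply_of_ne_of_ne h1 h2]
  have hfix : weightRep n l (Equiv.swap p q) (rowVector l T) = rowVector l T := by
    rw [weightRep_rowVector]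
    refine rowVector_congr fun e => ?_
    rw [row_relabel, Equiv.symm_swap]
    by_cases h1 : e = p
    · rw [h1, Equiv.swap_apply_left]
      exact iff_of_false (hTc q hqc) (hTc p hpc)
    by_cases h2 : e = q
    · rw [h2, Equiv.swap_apply_right]
      exact iff_of_false (hTc p hpc) (hTc q hqc)
    rw [Equiv.swap_apply_of_ne_of_ne h1 h2]
  have h := weightRep_inner (Equiv.swap p q) (rowVector l T) (polytabloid l T')
  rw [hfix, weightRep_polytabloid_of_mem hmem, Equiv.Perm.sign_swap hpq] at h
  simp only [Units.val_neg, Units.val_one, Int.cast_neg, Int.cast_one, neg_smul, one_smul]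
    at h
  exact self_eq_neg.1
    (h.symm.trans (inner_neg_right (𝕜 := ℂ) (E := weightSpace n l) _ _))

theorem isOrtho_spechtSubrep_of_lt {i j : ℕ} (hi : 2 * i ≤ n) (hj : 2 * j ≤ n) (hij : i < j) :
    Submodule.IsOrtho (𝕜 := ℂ) (E := weightSpace n l)
      (spechtSubrep n l (twoRowDiagram n i hi)).toSubmodule
      (spechtSubrep n l (twoRowDiagram n j hj)).toSubmodule := by
  refine Submodule.isOrtho_span.2 ?_
  rintro _ ⟨T, rfl⟩ _ ⟨T', rfl⟩
  -- Each term of the left polytabloid is, up to sign, the row vector of a relabelled tableau of the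
  -- same shape.
  rw [polytabloid, weightSpace_sum_inner]
  refine Finset.sum_eq_zero fun σ _ => ?_
  rw [weightSpace_inner_smul_left, weightRep_rowVector, inner_rowVector_polytabloid hij, mul_zero]

/-- The coefficient at a well-chosen string `z` is `1`: only the identity of the column stabilizer
contributes there. -/
theorem polytabloid_ne_zero {j : ℕ} {hj : 2 * j ≤ n} (hl : l ≤ n) (hjl : j ≤ min l (n - l))
    (T : YoungTableau n (twoRowDiagram n j hj)) : polytabloid l T ≠ 0 := by
  classical
  -- `z` has exactly one `1` in each of the first `l` columns: in the second row for columns below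
  -- `j`, in the first row from there on.
  let z : Fin n → Fin 2 := fun i => if T.row i = 1 ∨ (j ≤ T.col i ∧ T.col i < l) then 1 else 0
  have hz1 (i : Fin n) : z i = 1 ↔ T.row i = 1 ∨ (j ≤ T.col i ∧ T.col i < l) := by
    by_cases h : T.row i = 1 ∨ (j ≤ T.col i ∧ T.col i < l) <;> simp only [z, h] <;> simp
  have hz : hammingNorm z = l := by
    rw [← Finset.card_range l, hammingNorm]
    have h0 (i : Fin n) : z i ≠ 0 ↔ T.row i = 1 ∨ (j ≤ T.col i ∧ T.col i < l) := by
      by_cases h : T.row i = 1 ∨ (j ≤ T.col i ∧ T.col i < l) <;> simp only [z, h] <;> simp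
    refine Finset.card_bij (fun i _ => T.col i) ?_ ?_ ?_
    · intro i hi
      have := row_col_twoRow T i
      have := (h0 i).1 (Finset.mem_filter.1 hi).2
      rw [Finset.mem_range]
      omega
    · intro i hi k hk hik
      have h1 := row_col_twoRow T i
      have h2 := row_col_twoRow T k
      have h3 := (h0 i).1 (Finset.mem_filter.1 hi).2
      have h4 := (h0 k).1 (Finset.mem_filter.1 hk).2
      replace hik : T.col i = T.col k := hik
      exact T.ext_row_col (by omega) hik
    · intro c hc
      rw [Finset.mem_range] at hc
      by_cases hcj : c < j
      · obtain ⟨i, hi, hic⟩ := exists_entry_of_mem T (Or.inr ⟨rfl, hcj⟩)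
        exact ⟨i, Finset.mem_filter.2 ⟨Finset.mem_univ _, (h0 i).2 (Or.inl hi)⟩, hic⟩
      · obtain ⟨i, hi, hic⟩ := exists_entry_of_mem T (Or.inl ⟨rfl, (by omega : c < n - j)⟩)
        exact ⟨i, Finset.mem_filter.2 ⟨Finset.mem_univ _, (h0 i).2 (Or.inr (by omega))⟩, hic⟩
  intro h0
  have h1 : (polytabloid l T : QubitSpace n) z = 1 := by
    rw [polytabloid, Submodule.coe_sum, WithLp.ofLp_sum, Finset.sum_apply,
      Finset.sum_eq_single 1]
    · rw [Submodule.coe_smul, PiLp.smul_apply, weightRep_apply_coe, rowVector_apply,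
        if_pos ⟨hz, fun i hi => (hz1 i).2 (Or.inl hi)⟩]
      simp
    · intro σ hσ hσ1
      rw [Submodule.coe_smul, PiLp.smul_apply, weightRep_apply_coe, rowVector_apply, if_neg,
        smul_zero]
      rintro ⟨-, hrow⟩
      rw [mem_colStabilizer] at hσ
      -- In a column of length two the only `1` of `z` is in the second row, so a contributing `σ`,
      -- which preserves columns, fixes every second-row entry.
      have hfix (i : Fin n) (hi : T.row i = 1) : σ i = i := by
        have h2 := (hz1 _).1 (hrow i hi)
        have h3 := row_col_twoRow T i
        have h4 := hσ i
        exact T.ext_row_col (by omega) h4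
      refine hσ1 (Equiv.ext fun i => ?_)
      rw [Equiv.Perm.one_apply]
      by_cases h2 : T.row (σ i) = 1
      · exact σ.injective (hfix _ h2)
      · by_cases h3 : T.row i = 1
        · exact hfix i h3
        · have h4 := row_col_twoRow T i
          have h5 := row_col_twoRow T (σ i)
          exact T.ext_row_col (by omega) (hσ i)
    · intro h
      exact absurd (mem_colStabilizer.2 fun i => rfl) h
  rw [h0] at h1
  simp at h1

end TwoRowTableaux

/-! ### From the left ideal of a Young symmetrizer to the polytabloids. -/

section YoungIdeal

open Representation YoungTableau

variable {n l : ℕ} {μ : YoungDiagram}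

theorem asAlgebraHom_mem_subrep {k G V : Type*} [CommSemiring k] [Monoid G] [AddCommMonoid V]
    [Module k V] {ρ : Representation k G V} (W : Subrepresentation ρ) (u : MonoidAlgebra k G)
    {v : V} (hv : v ∈ W.toSubmodule) : ρ.asAlgebraHom u v ∈ W.toSubmodule := by
  induction u using MonoidAlgebra.induction_linear with
  | zero => simp
  | add x y hx hy =>
    rw [map_add, LinearMap.add_apply]
    exact W.toSubmodule.add_mem hx hy
  | single g a =>
    rw [asAlgebraHom_single, LinearMap.smul_apply]
    exact W.toSubmodule.smul_mem a (W.apply_mem_toSubmodule g hv)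

theorem asAlgebraHom_colAntisymmetrizer (T : YoungTableau n μ) :
    (weightRep n l).asAlgebraHom T.colAntisymmetrizer (rowVector l T) = polytabloid l T := by
  rw [colAntisymmetrizer, map_sum, LinearMap.sum_apply]
  refine Finset.sum_congr rfl fun σ _ => ?_
  rw [map_smul, asAlgebraHom_of, LinearMap.smul_apply]

theorem one_mem_rowStabilizer (T : YoungTableau n μ) : 1 ∈ T.rowStabilizer :=
  mem_rowStabilizer.2 fun _ => rfl

theorem card_rowStabilizer_ne_zero (T : YoungTableau n μ) : (T.rowStabilizer.card : ℂ) ≠ 0 :=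
  Nat.cast_ne_zero.2 (Finset.card_ne_zero_of_mem (one_mem_rowStabilizer T))

theorem asAlgebraHom_rowSymmetrizer (T : YoungTableau n μ) :
    (weightRep n l).asAlgebraHom T.rowSymmetrizer (rowVector l T) =
      (T.rowStabilizer.card : ℂ) • rowVector l T := by
  rw [rowSymmetrizer, map_sum, LinearMap.sum_apply, Nat.cast_smul_eq_nsmul, ← Finset.sum_const]
  refine Finset.sum_congr rfl fun σ hσ => ?_
  rw [asAlgebraHom_of, weightRep_rowVector]
  refine rowVector_congr fun i => ?_
  rw [row_relabel, ← mem_rowStabilizer.1 hσ (σ.symm i), Equiv.apply_symm_apply]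

/-- The row symmetrizer multiplies the row vector by the order of the row stabilizer, a nonzero
scalar; the column antisymmetrizer then produces the polytabloid. -/
theorem asAlgebraHom_mul_youngSymmetrizer (T : YoungTableau n μ)
    (u : MonoidAlgebra ℂ (Equiv.Perm (Fin n))) :
    (weightRep n l).asAlgebraHom (u * T.youngSymmetrizer) (rowVector l T) =
      (T.rowStabilizer.card : ℂ) • (weightRep n l).asAlgebraHom u (polytabloid l T) := by
  rw [youngSymmetrizer, map_mul, map_mul, Module.End.mul_apply, Module.End.mul_apply,
    asAlgebraHom_rowSymmetrizer, map_smul, map_smul, asAlgebraHom_colAntisymmetrizer]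

theorem mem_youngIdeal {T : YoungTableau n μ} {w : MonoidAlgebra ℂ (Equiv.Perm (Fin n))} :
    w ∈ T.youngIdeal ↔ ∃ u, u * T.youngSymmetrizer = w :=
  Submodule.mem_span_singleton

theorem asAlgebraHom_rowVector_mem (T : YoungTableau n μ) (w : T.youngIdeal) :
    (weightRep n l).asAlgebraHom w.1 (rowVector l T) ∈ (spechtSubrep n l μ).toSubmodule := by
  obtain ⟨u, hu⟩ := mem_youngIdeal.1 w.2
  rw [← hu, asAlgebraHom_mul_youngSymmetrizer]
  exact Submodule.smul_mem _ _ (asAlgebraHom_mem_subrep _ u (polytabloid_mem l T))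

theorem youngRep_apply_coe (T : YoungTableau n μ) (g : Equiv.Perm (Fin n)) (w : T.youngIdeal) :
    (T.youngRep g w).1 = MonoidAlgebra.of ℂ _ g * w.1 := rfl

/-- The intertwining map from the left ideal of the Young symmetrizer of `T` to the span of the
polytabloids that sends `w` to `w • rowVector l T`. -/
noncomputable def youngToSpecht (l : ℕ) (T : YoungTableau n μ) :
    IntertwiningMap T.youngRep (spechtSubrep n l μ).toRepresentation where
  toFun w := ⟨(weightRep n l).asAlgebraHom w.1 (rowVector l T), asAlgebraHom_rowVector_mem T w⟩
  map_add' u w := Subtype.ext (by simp)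
  map_smul' a w := Subtype.ext (by simp)
  isIntertwining' g := LinearMap.ext fun w => Subtype.ext (by
    change (weightRep n l).asAlgebraHom (T.youngRep g w).1 (rowVector l T) =
      weightRep n l g ((weightRep n l).asAlgebraHom w.1 (rowVector l T))
    rw [youngRep_apply_coe, map_mul, asAlgebraHom_of, Module.End.mul_apply])

theorem youngToSpecht_surjective (l : ℕ) (T : YoungTableau n μ) :
    Function.Surjective (youngToSpecht l T) := by
  rintro ⟨v, hv⟩
  suffices h : ∃ w : T.youngIdeal, (weightRep n l).asAlgebraHom w.1 (rowVector l T) = v from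
    h.imp fun w hw => Subtype.ext hw
  induction hv using Submodule.span_induction with
  | mem v h =>
    obtain ⟨T', rfl⟩ := h
    obtain ⟨g, rfl⟩ := exists_eq_relabel T T'
    refine ⟨⟨((T.rowStabilizer.card : ℂ)⁻¹ • MonoidAlgebra.of ℂ _ g) * T.youngSymmetrizer,
      mem_youngIdeal.2 ⟨_, rfl⟩⟩, ?_⟩
    rw [asAlgebraHom_mul_youngSymmetrizer, map_smul, asAlgebraHom_of, LinearMap.smul_apply,
      smul_smul, mul_inv_cancel₀ (card_rowStabilizer_ne_zero T), one_smul, weightRep_polytabloid]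
  | zero => exact ⟨0, by simp⟩
  | add u v _ _ hu hv =>
    obtain ⟨a, rfl⟩ := hu
    obtain ⟨b, rfl⟩ := hv
    exact ⟨a + b, by simp⟩
  | smul c v _ hv =>
    obtain ⟨a, rfl⟩ := hv
    exact ⟨c • a, by simp⟩

theorem rowSymmetrizer_mul_of (T : YoungTableau n μ) {r : Equiv.Perm (Fin n)}
    (hr : r ∈ T.rowStabilizer) :
    T.rowSymmetrizer * MonoidAlgebra.of ℂ _ r = T.rowSymmetrizer := by
  rw [rowSymmetrizer, Finset.sum_mul]
  refine Finset.sum_equiv (Equiv.mulRight r) (fun σ => ?_) fun σ _ => ?_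
  · rw [mem_rowStabilizer] at hr
    simp only [mem_rowStabilizer, Equiv.coe_mulRight, Equiv.Perm.mul_apply]
    refine ⟨fun h i => (h _).trans (hr i), fun h i => ?_⟩
    have h1 := h (r.symm i)
    have h2 := hr (r.symm i)
    rw [Equiv.apply_symm_apply] at h1 h2
    exact h1.trans h2.symm
  · rw [Equiv.coe_mulRight, map_mul]

/-- The elements of the left ideal of a Young symmetrizer are right invariant under the row
stabilizer. -/
theorem youngIdeal_apply_mul {T : YoungTableau n μ} (w : T.youngIdeal)
    {r : Equiv.Perm (Fin n)} (hr : r ∈ T.rowStabilizer) (g : Equiv.Perm (Fin n)) :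
    w.1.coeff (g * r) = w.1.coeff g := by
  obtain ⟨u, hu⟩ := mem_youngIdeal.1 w.2
  have h : w.1 * MonoidAlgebra.of ℂ _ r = w.1 := by
    rw [← hu, youngSymmetrizer, mul_assoc, mul_assoc, rowSymmetrizer_mul_of T hr]
  conv_lhs => rw [← h]
  rw [MonoidAlgebra.of_apply,
    MonoidAlgebra.coeff_mul_single_eq_coeff_mul g fun _ _ => mul_left_inj r, mul_one]

/-- A permutation that maps the second row of a two-row tableau to itself preserves the rows. -/
theorem mem_rowStabilizer_twoRow {j : ℕ} {h : 2 * j ≤ n}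
    {T : YoungTableau n (twoRowDiagram n j h)} {r : Equiv.Perm (Fin n)} :
    r ∈ T.rowStabilizer ↔ ∀ i, T.row i = 1 → T.row (r i) = 1 := by
  rw [mem_rowStabilizer]
  refine ⟨fun hr i hi => (hr i).trans hi, fun hr => ?_⟩
  -- By finiteness, mapping the second row into itself means mapping it onto itself, so the first
  -- row is preserved too.
  have himg : (Finset.univ.filter fun i => T.row i = 1).map r.toEmbedding =
      Finset.univ.filter fun i => T.row i = 1 := by
    refine Finset.eq_of_subset_of_card_le (fun i hi => ?_) (by rw [Finset.card_map])
    obtain ⟨k, hk, rfl⟩ := Finset.mem_map.1 hi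
    exact Finset.mem_filter.2 ⟨Finset.mem_univ _, hr k (Finset.mem_filter.1 hk).2⟩
  intro i
  have h1 := row_col_twoRow T i
  have h2 := row_col_twoRow T (r i)
  by_cases hi : T.row i = 1
  · rw [hi, hr i hi]
  · by_cases hri : T.row (r i) = 1
    · have hm : r i ∈ (Finset.univ.filter fun i => T.row i = 1).map r.toEmbedding := by
        rw [himg]
        exact Finset.mem_filter.2 ⟨Finset.mem_univ _, hri⟩
      obtain ⟨k, hk, hki⟩ := Finset.mem_map.1 hm
      rw [← r.injective hki] at hi
      exact absurd (Finset.mem_filter.1 hk).2 hi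
    · omega

theorem asAlgebraHom_apply_coe (w : MonoidAlgebra ℂ (Equiv.Perm (Fin n))) (v : weightSpace n l)
    (z : Fin n → Fin 2) :
    ((weightRep n l).asAlgebraHom w v : QubitSpace n) z =
      ∑ g, w.coeff g * (v : QubitSpace n) (z ∘ g) := by
  induction w using MonoidAlgebra.induction_linear with
  | zero => simp
  | add x y hx hy =>
    simp [add_mul, Finset.sum_add_distrib, hx, hy]
  | single g a =>
    rw [asAlgebraHom_single, LinearMap.smul_apply, Submodule.coe_smul, PiLp.smul_apply,
      weightRep_apply_coe, Finset.sum_eq_single g]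
    · simp
    · intro h _ hh
      simp [hh.symm]
    · simp

/-- In weight `j` the row vector is the single basis vector `|t⟩`, with `t` the indicator of the
second row, whose stabilizer is the row stabilizer. Elements of the ideal are constant on left
cosets of that stabilizer, so their coefficients can be read off from their action on `|t⟩`. -/
theorem youngToSpecht_injective {j : ℕ} {h : 2 * j ≤ n}
    (T : YoungTableau n (twoRowDiagram n j h)) : Function.Injective (youngToSpecht j T) := by
  classical
  suffices hker : ∀ w : T.youngIdeal,
      (weightRep n j).asAlgebraHom w.1 (rowVector j T) = 0 → w = 0 by
    refine (injective_iff_map_eq_zero (youngToSpecht j T)).2 fun w hw => ?_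
    exact hker w (congrArg Subtype.val hw)
  intro w hw
  refine Subtype.ext (MonoidAlgebra.ext (Finsupp.ext fun g => ?_))
  let t : Fin n → Fin 2 := fun i => if T.row i = 1 then 1 else 0
  have ht1 (i : Fin n) : t i = 1 ↔ T.row i = 1 := by
    by_cases h : T.row i = 1 <;> simp [t, h]
  have ht : hammingNorm t = j := by
    rw [← card_secondRow T, hammingNorm]
    congr 1
    ext i
    by_cases h : T.row i = 1 <;> simp [t, h]
  have h0 : ((weightRep n j).asAlgebraHom w.1 (rowVector j T) : QubitSpace n) (t ∘ g.symm) = 0 := by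
    rw [hw]; rfl
  have hsum : ((weightRep n j).asAlgebraHom w.1 (rowVector j T) : QubitSpace n) (t ∘ g.symm) =
      ∑ k with g⁻¹ * k ∈ T.rowStabilizer, w.1.coeff g := by
    -- Only `k` in the coset of `g` contributes, and there the coefficient of `w` is the one at `g`.
    rw [asAlgebraHom_apply_coe, Finset.sum_filter]
    refine Finset.sum_congr rfl fun k _ => ?_
    rw [rowVector_apply, hammingNorm_comp_perm, hammingNorm_comp_perm]
    have hiff : (hammingNorm t = j ∧ ∀ i, T.row i = 1 → ((t ∘ g.symm) ∘ k) i = 1) ↔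
        g⁻¹ * k ∈ T.rowStabilizer := by
      rw [mem_rowStabilizer_twoRow, and_iff_right ht]
      exact forall_congr' fun i => imp_congr_right fun _ => ht1 _
    rw [if_congr hiff rfl rfl]
    split_ifs with hk
    · rw [mul_one, ← youngIdeal_apply_mul w hk g, mul_inv_cancel_left]
    · rw [mul_zero]
  rw [hsum, Finset.sum_const, smul_eq_zero] at h0
  refine h0.resolve_left (Finset.card_ne_zero_of_mem (a := g) ?_)
  exact Finset.mem_filter.2 ⟨Finset.mem_univ _, by
    rw [inv_mul_cancel]; exact one_mem_rowStabilizer T⟩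

end YoungIdeal

/-! ### Assembling the decomposition. -/

section Main

open Representation

variable {n l : ℕ}

theorem isOrtho_spechtSubrep (m : ℕ) (hm : ∀ j : Fin (m + 1), 2 * (j : ℕ) ≤ n)
    (i j : Fin (m + 1)) (hij : i ≠ j) :
    Submodule.IsOrtho (𝕜 := ℂ) (E := weightSpace n l)
      (spechtSubrep n l (twoRowDiagram n i (hm i))).toSubmodule
      (spechtSubrep n l (twoRowDiagram n j (hm j))).toSubmodule := by
  rcases lt_or_gt_of_ne hij with h | h
  · exact isOrtho_spechtSubrep_of_lt _ _ h
  · exact (isOrtho_spechtSubrep_of_lt _ _ h).symm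

theorem spechtSubrep_ne_bot {j : ℕ} (hj : 2 * j ≤ n) (hl : l ≤ n) (hjl : j ≤ min l (n - l)) :
    (spechtSubrep n l (twoRowDiagram n j hj)).toSubmodule ≠ ⊥ := by
  obtain ⟨T⟩ := youngTableau_twoRow_nonempty n j hj
  intro h
  have := polytabloid_mem l T
  rw [h, Submodule.mem_bot] at this
  exact polytabloid_ne_zero hl hjl T this

theorem isIrreducible_spechtSubrep {j : ℕ} (hj : 2 * j ≤ n) (hl : l ≤ n)
    (hjl : j ≤ min l (n - l)) :
    (spechtSubrep n l (twoRowDiagram n j hj)).toRepresentation.IsIrreducible := by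
  have hm (i : Fin (min l (n - l) + 1)) : 2 * (i : ℕ) ≤ n := by have := i.isLt; omega
  exact isIrreducible_of_finrank_commutant_le (E := weightSpace n l) (ρ := weightRep n l)
    (B := fun i : Fin (min l (n - l) + 1) => spechtSubrep n l (twoRowDiagram n i (hm i)))
    (by exact weightRep_inner) (isOrtho_spechtSubrep _ hm)
    (fun i => spechtSubrep_ne_bot _ hl (Nat.lt_succ_iff.1 i.isLt))
    ((finrank_intertwiningMap_weightRep_le n l).trans (Fintype.card_fin _).ge)
    ⟨j, Nat.lt_succ_iff.2 hjl⟩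

theorem nonempty_equiv_youngRep {j : ℕ} (hj : 2 * j ≤ n) (hl : l ≤ n)
    (hjl : j ≤ min l (n - l)) (T : YoungTableau n (twoRowDiagram n j hj)) :
    Nonempty ((spechtSubrep n l (twoRowDiagram n j hj)).toRepresentation.Equiv T.youngRep) := by
  let e : T.youngRep.Equiv (spechtSubrep n j (twoRowDiagram n j hj)).toRepresentation :=
    (youngToSpecht j T).ofBijective ⟨youngToSpecht_injective T, youngToSpecht_surjective j T⟩
  let f : IntertwiningMap (spechtSubrep n j (twoRowDiagram n j hj)).toRepresentation
      (spechtSubrep n l (twoRowDiagram n j hj)).toRepresentation :=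
    (youngToSpecht l T).comp e.symm.toIntertwiningMap
  -- Weight `j` itself is admissible for the block `j`, since `2 * j ≤ n` gives `j ≤ min j (n - j)`.
  have hirr : (spechtSubrep n j (twoRowDiagram n j hj)).toRepresentation.IsIrreducible :=
    isIrreducible_spechtSubrep hj (by omega) (by omega)
  have hsurj : Function.Surjective f :=
    (youngToSpecht_surjective l T).comp e.symm.toLinearEquiv.surjective
  -- Schur: an intertwiner out of an irreducible representation is injective or zero, and `f` maps
  -- onto a nonzero space.
  have hinj : Function.Injective f := by
    refine (IsIrreducible.injective_or_eq_zero f).resolve_right fun h0 => ?_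
    refine spechtSubrep_ne_bot hj hl hjl ((Submodule.eq_bot_iff _).2 fun v hv => ?_)
    obtain ⟨u, hu⟩ := hsurj ⟨v, hv⟩
    rw [h0] at hu
    exact (congrArg Subtype.val hu).symm
  exact ⟨(e.trans (f.ofBijective ⟨hinj, hsurj⟩)).symm⟩

theorem exists_distanceOperator_eq_sum {ι : Type*} [Fintype ι]
    {B : ι → Subrepresentation (weightRep n l)}
    (horth : ∀ i j, i ≠ j →
      Submodule.IsOrtho (𝕜 := ℂ) (E := weightSpace n l) (B i).toSubmodule (B j).toSubmodule)
    (hne : ∀ i, (B i).toSubmodule ≠ ⊥)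
    (hdim : Module.finrank ℂ (IntertwiningMap (weightRep n l) (weightRep n l)) ≤ Fintype.card ι)
    (k : ℕ) : ∃ α : ι → ℝ,
      distanceOperator n l k = ∑ j, (α j : ℂ) • weightProj (B j).toSubmodule ∧
      ∀ j, Module.End.HasEigenvalue (distanceOperator n l k).toLinearMap (α j : ℂ) := by
  have h := exists_eq_sum_starProjection_of_isSymmetric (E := weightSpace n l)
    (ρ := weightRep n l) (B := B) (by exact weightRep_inner) horth hne hdim
    (distanceOperator n l k)
  obtain ⟨α, h1, h2⟩ := h (distanceOperator_isSymmetric n l k)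
    (fun g v => distanceOperator_comm k g v)
  exact ⟨α, h1, h2⟩

end Main

theorem mainTheorem4 (n l : ℕ) (hl : l ≤ n) :
    ∃ B : Fin (min l (n - l) + 1) → Subrepresentation (weightRep n l),
      -- the space is the internal, orthogonal direct sum of the `B j`
      DirectSum.IsInternal (fun j => (B j).toSubmodule) ∧
      (∀ i j, i ≠ j → Submodule.IsOrtho (𝕜 := ℂ) (E := weightSpace n l) (B i).toSubmodule (B j).toSubmodule) ∧
      -- every `B j` is irreducible
      (∀ j, (B j).toRepresentation.IsIrreducible) ∧
      -- `B j` is the irrep labelled by the partition `(n - j, j)`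
      (∀ (j : Fin (min l (n - l) + 1))
        (T : YoungTableau n (twoRowDiagram n j (by have := j.isLt; omega))),
        Nonempty ((B j).toRepresentation.Equiv T.youngRep)) ∧
      -- every irrep appears at most once
      (∀ i j, i ≠ j → IsEmpty ((B i).toRepresentation.Equiv (B j).toRepresentation)) ∧
      -- the operators `A_k` are combinations of the orthogonal projections onto the `B j`
      ∃ α : ℕ → Fin (min l (n - l) + 1) → ℝ, ∀ k : ℕ,
        distanceOperator n l k = ∑ j, (α k j : ℂ) • weightProj (B j).toSubmodule ∧
        ∀ j, Module.End.HasEigenvalue (distanceOperator n l k).toLinearMap (α k j : ℂ) := by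
  have hm (i : Fin (min l (n - l) + 1)) : 2 * (i : ℕ) ≤ n := by have := i.isLt; omega
  have hle (i : Fin (min l (n - l) + 1)) : (i : ℕ) ≤ min l (n - l) := Nat.lt_succ_iff.1 i.isLt
  let B (i : Fin (min l (n - l) + 1)) := spechtSubrep n l (twoRowDiagram n i (hm i))
  have horth := isOrtho_spechtSubrep (l := l) _ hm
  have hne (i : Fin (min l (n - l) + 1)) : (B i).toSubmodule ≠ ⊥ :=
    spechtSubrep_ne_bot (hm i) hl (hle i)
  have hdim : Module.finrank ℂ (Representation.IntertwiningMap (weightRep n l) (weightRep n l)) ≤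
      Fintype.card (Fin (min l (n - l) + 1)) :=
    (finrank_intertwiningMap_weightRep_le n l).trans (Fintype.card_fin _).ge
  have hint := isInternal_of_finrank_commutant_le (E := weightSpace n l) (ρ := weightRep n l)
    (B := B) (by exact weightRep_inner) horth hne hdim
  have hniso := isEmpty_equiv_of_finrank_commutant_le (E := weightSpace n l)
    (ρ := weightRep n l) (B := B) (by exact weightRep_inner) horth hne hdim
  choose α hα using fun k => exists_distanceOperator_eq_sum horth hne hdim k
  exact ⟨B, hint, horth, fun j => isIrreducible_spechtSubrep (hm j) hl (hle j),
    fun j T => nonempty_equiv_youngRep (hm j) hl (hle j) T, hniso, α, hα⟩
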